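/- Let $U:\mathbb{R}^d\to\mathbb{R}^d$ be globally Lipschitz and $\mu\in\mathbb{R}^d$. For $\eta,\tau,\sigma>0$ let $\theta_k\sim\rho_k=\mathcal N(\mu,\tau I)$ and $\varepsilon\sim\mathcal N(0,I)$ be independent, put $\theta_{k+1}=\theta_k-\eta U(\theta_k)+\sigma\varepsilon$, and let $\rho_{k+1}$ be the law of $\theta_{k+1}$. Let $$p(y\mid x)=(2\pi\sigma^2)^{-d/2}\exp\Big(-\tfrac{\|y-x+\eta U(x)\|^2}{2\sigma^2}\Big)$$ be the transition density, and define $\Delta S_{\rm tot}=\Delta S_{\rm bath}+\Delta S_{\rm sys}$, where $$\Delta S_{\rm bath}=\ln\frac{p(\theta_{k+1}\mid\theta_k)}{p(\theta_k\mid\theta_{k+1})},\qquad \Delta S_{\rm sys}=H(\rho_{k+1})-H(\rho_k),$$ and $H(\rho)=-\int\rho(x)\ln\rho(x)\,dx$ is the Shannon (differential) entropy of a law with Lebesgue density $\rho(x)$. Let $\phi_{\rm ST}(\theta)=\frac{\eta}{4}\|U(\theta)\|^2$. Then, for all $\eta,\tau,\sigma>0$, both laws $\rho_k,\rho_{k+1}$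 have Lebesgue densities with absolutely convergent entropy integrals, and $\Delta S_{\rm tot}$ is integrable. For every $\eta>0$ the limit $\lim_{\sigma\to0^+}\sigma^2\,\mathbb E[\Delta S_{\rm tot}]$ exists for every $\tau>0$, the limit of the result as $\tau\to0^+$ exists, and, for fixed $U$ and $\mu$, as $\eta\to0^+$, $$\lim_{\tau\to0}\Big(\lim_{\sigma^2\to0}\sigma^2\,\mathbb E[\Delta S_{\rm tot}]\Big)=8\eta\,\phi_{\rm ST}(\mu)+O(\eta^3).$$ -/

import Mathlib

open MeasureTheory ProbabilityTheory Filter Topology Asymptotics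

noncomputable section

namespace EntropyProduction

variable {d : ℕ}

/-- The isotropic Gaussian law `N(m, v I)` on `ℝ^d`. -/
def isoGaussian (m : EuclideanSpace ℝ (Fin d)) (v : ℝ) : Measure (EuclideanSpace ℝ (Fin d)) :=
  multivariateGaussian m (v • (1 : Matrix (Fin d) (Fin d) ℝ))

/-- The Lebesgue density at `x` of the isotropic Gaussian law `N(m, v I)` on `ℝ^d`, for `v > 0`. -/
def isoGaussianDensity (m : EuclideanSpace ℝ (Fin d)) (v : ℝ) (x : EuclideanSpace ℝ (Fin d)) : ℝ :=
  (2 * Real.pi * v) ^ (-(d : ℝ) / 2) * Real.exp (-‖x - m‖ ^ 2 / (2 * v))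

/-- The joint law of `(θ_k, θ_{k+1})`, where `θ_{k+1} = θ_k - η U(θ_k) + σ ε`, with
`θ_k ~ N(μ, τ I)` and `ε ~ N(0, I)` independent. -/
def jointLaw (U : EuclideanSpace ℝ (Fin d) → EuclideanSpace ℝ (Fin d))
    (μ : EuclideanSpace ℝ (Fin d)) (η τ σ : ℝ) :
    Measure (EuclideanSpace ℝ (Fin d) × EuclideanSpace ℝ (Fin d)) :=
  ((isoGaussian μ τ).prod (isoGaussian 0 1)).map
    (fun z => (z.1, z.1 - η • U z.1 + σ • z.2))

/-- The law of `θ_{k+1}`. -/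
def nextLaw (U : EuclideanSpace ℝ (Fin d) → EuclideanSpace ℝ (Fin d))
    (μ : EuclideanSpace ℝ (Fin d)) (η τ σ : ℝ) : Measure (EuclideanSpace ℝ (Fin d)) :=
  (jointLaw U μ η τ σ).map Prod.snd

/-- The transition density `p(y | x)` of the noisy update: the density at `y` of
`N(x - η U(x), σ² I)`. -/
def transitionDensity (U : EuclideanSpace ℝ (Fin d) → EuclideanSpace ℝ (Fin d)) (η σ : ℝ)
    (y x : EuclideanSpace ℝ (Fin d)) : ℝ :=
  isoGaussianDensity (x - η • U x) (σ ^ 2) y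

/-- The bath entropy production of the transition `x → y`: the log-ratio of the forward to the
backward transition density. -/
def bathEntropy (U : EuclideanSpace ℝ (Fin d) → EuclideanSpace ℝ (Fin d)) (η σ : ℝ)
    (x y : EuclideanSpace ℝ (Fin d)) : ℝ :=
  Real.log (transitionDensity U η σ y x / transitionDensity U η σ x y)

/-- The integrand `-p log p` of the Shannon entropy, `p` being the Lebesgue density of `ν`. -/
def entropyIntegrand (ν : Measure (EuclideanSpace ℝ (Fin d))) (x : EuclideanSpace ℝ (Fin d)) : ℝ :=
  Real.negMulLog (ν.rnDeriv volume x).toReal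

/-- The (differential) Shannon entropy `-∫ p log p` of an absolutely continuous law. -/
def shannonEntropy (ν : Measure (EuclideanSpace ℝ (Fin d))) : ℝ :=
  ∫ x, entropyIntegrand ν x

/-- The law `ν` has a well-defined, finite Shannon entropy. -/
def HasShannonEntropy (ν : Measure (EuclideanSpace ℝ (Fin d))) : Prop :=
  ν ≪ volume ∧ Integrable (entropyIntegrand ν) volume

/-- The system entropy change: the Shannon entropy of the law of `θ_{k+1}` minus that of the law
of `θ_k`. -/
def systemEntropy (U : EuclideanSpace ℝ (Fin d) → EuclideanSpace ℝ (Fin d))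
    (μ : EuclideanSpace ℝ (Fin d)) (η τ σ : ℝ) : ℝ :=
  shannonEntropy (nextLaw U μ η τ σ) - shannonEntropy (isoGaussian μ τ)

/-- The total entropy production of the transition `z.1 → z.2`. -/
def totalEntropy (U : EuclideanSpace ℝ (Fin d) → EuclideanSpace ℝ (Fin d))
    (μ : EuclideanSpace ℝ (Fin d)) (η τ σ : ℝ)
    (z : EuclideanSpace ℝ (Fin d) × EuclideanSpace ℝ (Fin d)) : ℝ :=
  bathEntropy U η σ z.1 z.2 + systemEntropy U μ η τ σ

/-- The stochastic entropy potential. -/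
def phiST (U : EuclideanSpace ℝ (Fin d) → EuclideanSpace ℝ (Fin d)) (η : ℝ)
    (x : EuclideanSpace ℝ (Fin d)) : ℝ :=
  η / 4 * ‖U x‖ ^ 2

end EntropyProduction

end

/-!
Along a step `y = x - η U(x) + σ ε` the bath entropy production, multiplied by `σ²`, is a jointly
continuous function of `(σ, x, ε)` of polynomial growth, so its Gaussian average converges as
`σ → 0` by dominated convergence, and the limit concentrates at `μ` as `τ → 0`.

The system entropy does not contribute. The density of `θ_{k+1}` is at most `(2πσ²)^(-d/2)`, so its
entropy is at least `(d/2) log (2πσ²)`. By Gibbs' inequality against the standard Gaussian, its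
entropy is at most a constant plus half its second moment, which stays bounded as `σ → 0`. Both
bounds vanish after multiplication by `σ²`.

What remains is `(η²/2) ‖U(μ) + U(μ - η U(μ))‖²`, and the drift moves `U` by `O(η)`.
-/

noncomputable section

namespace EntropyProduction

open scoped RealInnerProductSpace

section PolynomialGrowth

variable {E F G : Type*} [SeminormedAddCommGroup E] [SeminormedAddCommGroup F]
  [SeminormedAddCommGroup G]

/-- Polynomial growth at infinity, together with boundedness on bounded sets: the bound is imposed
on the whole space. -/
def HasPolynomialGrowth (f : E → F) : Prop :=
  ∃ n : ℕ, f =O[⊤] fun x => (1 + ‖x‖) ^ n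

lemma isBigO_one_add_norm_pow_of_le {m n : ℕ} (hmn : m ≤ n) :
    (fun x : E => (1 + ‖x‖) ^ m) =O[⊤] fun x => (1 + ‖x‖) ^ n := by
  refine isBigO_of_le _ fun x => ?_
  rw [Real.norm_of_nonneg (by positivity), Real.norm_of_nonneg (by positivity)]
  exact pow_le_pow_right₀ (le_add_of_nonneg_right (norm_nonneg x)) hmn

namespace HasPolynomialGrowth

lemma of_lipschitzWith {K : NNReal} {f : E → F} (hf : LipschitzWith K f) :
    HasPolynomialGrowth f := by
  refine ⟨1, isBigO_top.2 ⟨‖f 0‖ + K, fun x => ?_⟩⟩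
  rw [pow_one, Real.norm_of_nonneg (by positivity)]
  have hK : ‖f x - f 0‖ ≤ K * ‖x‖ := by simpa only [sub_zero] using hf.norm_sub_le x 0
  have h0 := norm_le_norm_add_norm_sub' (f x) (f 0)
  have hcross : 0 ≤ K + ‖f 0‖ * ‖x‖ := by positivity
  linarith

lemma fst : HasPolynomialGrowth (Prod.fst : E × F → E) := of_lipschitzWith .prod_fst

lemma snd : HasPolynomialGrowth (Prod.snd : E × F → F) := of_lipschitzWith .prod_snd

lemma const (c : F) : HasPolynomialGrowth fun _ : E => c := of_lipschitzWith (.const c)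

lemma comp {g : F → G} {f : E → F} (hg : HasPolynomialGrowth g) (hf : HasPolynomialGrowth f) :
    HasPolynomialGrowth fun x => g (f x) := by
  obtain ⟨n, hg⟩ := hg
  obtain ⟨m, hf⟩ := hf
  have hone : (fun _ : E => (1 : ℝ)) =O[⊤] fun x => (1 + ‖x‖) ^ m := by
    simpa only [pow_zero] using isBigO_one_add_norm_pow_of_le (E := E) (Nat.zero_le m)
  refine ⟨m * n, (hg.comp_tendsto tendsto_top).trans ?_⟩
  simpa only [pow_mul, Function.comp_def] using (hone.add hf.norm_left).pow n

lemma add {f g : E → F} (hf : HasPolynomialGrowth f) (hg : HasPolynomialGrowth g) :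
    HasPolynomialGrowth fun x => f x + g x := by
  obtain ⟨m, hf⟩ := hf
  obtain ⟨n, hg⟩ := hg
  exact ⟨max m n, (hf.trans (isBigO_one_add_norm_pow_of_le (le_max_left m n))).add
    (hg.trans (isBigO_one_add_norm_pow_of_le (le_max_right m n)))⟩

lemma smul [NormedSpace ℝ F] {c : E → ℝ} {f : E → F} (hc : HasPolynomialGrowth c)
    (hf : HasPolynomialGrowth f) : HasPolynomialGrowth fun x => c x • f x := by
  obtain ⟨m, hc⟩ := hc
  obtain ⟨n, hf⟩ := hf
  exact ⟨m + n, by simpa only [pow_add, smul_eq_mul] using hc.smul hf⟩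

lemma sub {f g : E → F} (hf : HasPolynomialGrowth f) (hg : HasPolynomialGrowth g) :
    HasPolynomialGrowth fun x => f x - g x := by
  obtain ⟨m, hf⟩ := hf
  obtain ⟨n, hg⟩ := hg
  exact ⟨max m n, (hf.trans (isBigO_one_add_norm_pow_of_le (le_max_left m n))).sub
    (hg.trans (isBigO_one_add_norm_pow_of_le (le_max_right m n)))⟩

lemma norm_sq {f : E → F} (hf : HasPolynomialGrowth f) :
    HasPolynomialGrowth fun x => ‖f x‖ ^ 2 := by
  obtain ⟨n, hf⟩ := hf
  exact ⟨n * 2, by simpa only [pow_mul] using hf.norm_left.pow 2⟩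

lemma div_const {f : E → ℝ} (hf : HasPolynomialGrowth f) (c : ℝ) :
    HasPolynomialGrowth fun x => f x / c := by
  simpa only [div_eq_inv_mul, smul_eq_mul] using (const c⁻¹).smul hf

end HasPolynomialGrowth

end PolynomialGrowth

section Moments

variable {P E F : Type*} [SeminormedAddCommGroup P] [NormedAddCommGroup E] [MeasurableSpace E]
  [NormedAddCommGroup F] {ν : Measure E} [IsFiniteMeasure ν]

lemma integrable_one_add_norm_pow (hν : ∀ n : ℕ, MemLp id n ν) (n : ℕ) :
    Integrable (fun x => (1 + ‖x‖) ^ n) ν := by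
  have hnorm : MemLp (fun x : E => ‖x‖) n ν := (hν n).norm
  have hone : MemLp (fun x : E => 1 + ‖x‖) n ν := (memLp_const (1 : ℝ)).add hnorm
  refine hone.integrable_norm_pow'.congr (ae_of_all _ fun x => ?_)
  dsimp only
  rw [Real.norm_of_nonneg (by positivity)]

lemma HasPolynomialGrowth.integrable {f : E → F} (hf : HasPolynomialGrowth f)
    (hν : ∀ n : ℕ, MemLp id n ν) (hfm : AEStronglyMeasurable f ν) : Integrable f ν := by
  obtain ⟨n, hf⟩ := hf
  obtain ⟨C, hC⟩ := isBigO_top.1 hf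
  exact ((integrable_one_add_norm_pow hν n).norm.const_mul C).mono' hfm (ae_of_all _ hC)

lemma HasPolynomialGrowth.continuous_integral [OpensMeasurableSpace E]
    [SecondCountableTopologyEither E F] [NormedSpace ℝ F] {f : P × E → F}
    (hf : HasPolynomialGrowth f) (hν : ∀ n : ℕ, MemLp id n ν) (hfc : Continuous f) :
    Continuous fun p => ∫ x, f (p, x) ∂ν := by
  obtain ⟨n, hf⟩ := hf
  obtain ⟨C, hC0, hC⟩ := hf.exists_nonneg
  rw [isBigOWith_top] at hC
  refine continuous_iff_continuousAt.2 fun p₀ => ?_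
  have hnear : ∀ᶠ p in 𝓝 p₀, ‖p‖ < ‖p₀‖ + 1 :=
    continuous_norm.continuousAt.eventually_lt_const (lt_add_one _)
  refine continuousAt_of_dominated
    (bound := fun x => C * ((2 + ‖p₀‖) ^ n * (1 + ‖x‖) ^ n))
    (Eventually.of_forall fun p => (hfc.comp (.prodMk_right p)).aestronglyMeasurable) ?_
    (((integrable_one_add_norm_pow hν n).const_mul _).const_mul C)
    (ae_of_all _ fun x => (hfc.comp (.prodMk_left x)).continuousAt)
  filter_upwards [hnear] with p hp
  refine ae_of_all _ fun x => (hC (p, x)).trans ?_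
  have hnorm : 1 + ‖(p, x)‖ ≤ (2 + ‖p₀‖) * (1 + ‖x‖) := by
    have hmax : ‖(p, x)‖ ≤ ‖p‖ + ‖x‖ := max_le_add_of_nonneg (norm_nonneg p) (norm_nonneg x)
    have hcross : 0 ≤ ‖x‖ + ‖p₀‖ * ‖x‖ := by positivity
    linarith
  rw [Real.norm_of_nonneg (by positivity), ← mul_pow]
  gcongr

lemma HasPolynomialGrowth.integrable_prodMk_left [OpensMeasurableSpace E]
    [SecondCountableTopologyEither E F] {f : P × E → F} (hf : HasPolynomialGrowth f)
    (hν : ∀ n : ℕ, MemLp id n ν) (hfc : Continuous f) (p : P) :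
    Integrable (fun x => f (p, x)) ν :=
  (hf.comp (of_lipschitzWith (.prodMk_left p))).integrable hν
    (hfc.comp (.prodMk_right p)).aestronglyMeasurable

end Moments

section Gaussian

lemma memLp_id_natCast_of_isGaussian {E : Type*} [NormedAddCommGroup E] [NormedSpace ℝ E]
    [MeasurableSpace E] [BorelSpace E] [SecondCountableTopology E] [CompleteSpace E]
    (ν : Measure E) [IsGaussian ν] (n : ℕ) : MemLp id n ν :=
  IsGaussian.memLp_id ν n (ENNReal.natCast_ne_top n)

variable {d : ℕ}

instance isGaussian_isoGaussian (m : EuclideanSpace ℝ (Fin d)) (v : ℝ) :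
    IsGaussian (isoGaussian m v) :=
  isGaussian_multivariateGaussian

lemma charFun_isoGaussian (m : EuclideanSpace ℝ (Fin d)) {v : ℝ} (hv : 0 ≤ v)
    (t : EuclideanSpace ℝ (Fin d)) :
    charFun (isoGaussian m v) t =
      Complex.exp (⟪t, m⟫ * Complex.I - v * ‖t‖ ^ 2 / 2) := by
  have hquad : t ⬝ᵥ (v • (1 : Matrix (Fin d) (Fin d) ℝ)).mulVec t = v * ‖t‖ ^ 2 := by
    rw [Matrix.smul_mulVec, Matrix.one_mulVec, dotProduct_smul, EuclideanSpace.real_norm_sq_eq]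
    simp [dotProduct, sq]
  rw [isoGaussian, charFun_multivariateGaussian (Matrix.PosSemidef.one.smul hv), hquad]
  push_cast
  rfl

open scoped MatrixOrder in
lemma isoGaussian_eq_map (m : EuclideanSpace ℝ (Fin d)) {v : ℝ} (hv : 0 ≤ v) :
    isoGaussian m v = (isoGaussian 0 1).map (fun z => m + √v • z) := by
  have hsqrt : CFC.sqrt (v • (1 : Matrix (Fin d) (Fin d) ℝ)) = √v • 1 := by
    lift v to NNReal using hv
    simpa [Algebra.algebraMap_eq_smul_one, NNReal.smul_def] using
      CFC.sqrt_algebraMap (A := Matrix (Fin d) (Fin d) ℝ) (r := v)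
  rw [isoGaussian, isoGaussian, one_smul, multivariateGaussian_zero_one, multivariateGaussian,
    hsqrt]
  simp

lemma tendsto_integral_isoGaussian {F : Type*} [NormedAddCommGroup F] [NormedSpace ℝ F]
    [CompleteSpace F] {f : EuclideanSpace ℝ (Fin d) → F} (hfc : Continuous f)
    (hf : HasPolynomialGrowth f) (m : EuclideanSpace ℝ (Fin d)) :
    Tendsto (fun v : ℝ => ∫ x, f x ∂isoGaussian m v) (𝓝[>] 0) (𝓝 (f m)) := by
  have hgrowth : HasPolynomialGrowth fun w : ℝ × EuclideanSpace ℝ (Fin d) => f (m + w.1 • w.2) :=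
    hf.comp (.add (.const m) (.smul .fst .snd))
  have hcont : Continuous fun s : ℝ => ∫ z, f (m + s • z) ∂isoGaussian 0 1 :=
    hgrowth.continuous_integral (memLp_id_natCast_of_isGaussian _) (by fun_prop)
  have hlim := (hcont.comp Real.continuous_sqrt).tendsto 0
  simp only [Function.comp_apply, Real.sqrt_zero, zero_smul, add_zero, integral_const,
    probReal_univ, one_smul] at hlim
  refine (hlim.mono_left nhdsWithin_le_nhds).congr' ?_
  filter_upwards [self_mem_nhdsWithin] with v hv
  rw [isoGaussian_eq_map m (le_of_lt hv),
    integral_map (by fun_prop) hfc.aestronglyMeasurable]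
  rfl

lemma isoGaussianDensity_pos (m : EuclideanSpace ℝ (Fin d)) {v : ℝ} (hv : 0 < v)
    (x : EuclideanSpace ℝ (Fin d)) : 0 < isoGaussianDensity m v x := by
  unfold isoGaussianDensity
  positivity

lemma isoGaussianDensity_le (m : EuclideanSpace ℝ (Fin d)) {v : ℝ} (hv : 0 ≤ v)
    (x : EuclideanSpace ℝ (Fin d)) :
    isoGaussianDensity m v x ≤ (2 * Real.pi * v) ^ (-(d : ℝ) / 2) := by
  refine mul_le_of_le_one_right (by positivity) (Real.exp_le_one_iff.2 ?_)
  rw [neg_div]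
  exact neg_nonpos.2 (by positivity)

lemma log_isoGaussianDensity (m : EuclideanSpace ℝ (Fin d)) {v : ℝ} (hv : 0 < v)
    (x : EuclideanSpace ℝ (Fin d)) :
    Real.log (isoGaussianDensity m v x) =
      -(d : ℝ) / 2 * Real.log (2 * Real.pi * v) - ‖x - m‖ ^ 2 / (2 * v) := by
  rw [isoGaussianDensity, Real.log_mul (by positivity) (Real.exp_pos _).ne', Real.log_exp,
    Real.log_rpow (by positivity)]
  ring

lemma continuous_isoGaussianDensity (m : EuclideanSpace ℝ (Fin d)) (v : ℝ) :
    Continuous (isoGaussianDensity m v) := by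
  unfold isoGaussianDensity
  fun_prop

/-- The right-hand side is shaped for `GaussianFourier.integral_cexp_neg_mul_sq_norm_add`. -/
lemma ofReal_isoGaussianDensity_add_mul_cexp (m : EuclideanSpace ℝ (Fin d)) {v : ℝ} (hv : 0 ≤ v)
    (t x : EuclideanSpace ℝ (Fin d)) :
    (isoGaussianDensity m v (x + m) : ℂ) * Complex.exp (⟪x + m, t⟫ * Complex.I) =
      ((2 * Real.pi * v : ℝ) : ℂ) ^ (-((d : ℂ) / 2)) * Complex.exp (⟪t, m⟫ * Complex.I) *
        Complex.exp (-((2 * v)⁻¹ : ℝ) * ‖x‖ ^ 2 + Complex.I * ⟪t, x⟫) := by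
  rw [isoGaussianDensity, add_sub_cancel_right, Complex.ofReal_mul,
    Complex.ofReal_cpow (by positivity), Complex.ofReal_exp, mul_assoc, ← Complex.exp_add,
    mul_assoc (_ ^ _ : ℂ), ← Complex.exp_add, inner_add_left, real_inner_comm x, real_inner_comm m]
  push_cast
  rw [neg_div]
  congr 2
  ring

lemma integral_isoGaussianDensity_mul_cexp (m : EuclideanSpace ℝ (Fin d)) {v : ℝ} (hv : 0 < v)
    (t : EuclideanSpace ℝ (Fin d)) :
    ∫ x, (isoGaussianDensity m v x : ℂ) * Complex.exp (⟪x, t⟫ * Complex.I) =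
      Complex.exp (⟪t, m⟫ * Complex.I - v * ‖t‖ ^ 2 / 2) := by
  have hv' : (v : ℂ) ≠ 0 := Complex.ofReal_ne_zero.2 hv.ne'
  have hbase : (Real.pi : ℂ) / ((2 * v)⁻¹ : ℝ) = ((2 * Real.pi * v : ℝ) : ℂ) := by
    push_cast
    field_simp
  have hpow : ((2 * Real.pi * v : ℝ) : ℂ) ^ ((d : ℂ) / 2) ≠ 0 :=
    fun h => (Complex.ofReal_ne_zero.2 (by positivity)) (Complex.cpow_eq_zero_iff _ _ |>.1 h).1
  rw [← integral_add_right_eq_self _ m]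
  simp_rw [ofReal_isoGaussianDensity_add_mul_cexp m hv.le t]
  rw [integral_const_mul, GaussianFourier.integral_cexp_neg_mul_sq_norm_add
      (by rw [Complex.ofReal_re]; positivity), finrank_euclideanSpace_fin, hbase, Complex.cpow_neg,
    mul_mul_mul_comm, inv_mul_cancel₀ hpow, one_mul, ← Complex.exp_add, Complex.I_sq]
  congr 1
  push_cast
  field_simp
  ring

lemma integral_isoGaussianDensity (m : EuclideanSpace ℝ (Fin d)) {v : ℝ} (hv : 0 < v) :
    ∫ x, isoGaussianDensity m v x = 1 := by
  have h : ((∫ x, isoGaussianDensity m v x : ℝ) : ℂ) = 1 := by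
    simpa [integral_complex_ofReal] using integral_isoGaussianDensity_mul_cexp m hv 0
  exact_mod_cast h

lemma integrable_isoGaussianDensity (m : EuclideanSpace ℝ (Fin d)) {v : ℝ} (hv : 0 < v) :
    Integrable (isoGaussianDensity m v) :=
  .of_integral_ne_zero (by simp [integral_isoGaussianDensity m hv])

lemma isoGaussian_eq_withDensity (m : EuclideanSpace ℝ (Fin d)) {v : ℝ} (hv : 0 < v) :
    isoGaussian m v =
      volume.withDensity fun x => ENNReal.ofReal (isoGaussianDensity m v x) := by
  have := isFiniteMeasure_withDensity_ofReal (integrable_isoGaussianDensity m hv).2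
  refine Measure.ext_of_charFun (funext fun t => ?_)
  rw [charFun_isoGaussian m hv.le, charFun_apply, integral_withDensity_eq_integral_toReal_smul
    (continuous_isoGaussianDensity m v).measurable.ennreal_ofReal (by simp),
    ← integral_isoGaussianDensity_mul_cexp m hv t]
  simp only [ENNReal.toReal_ofReal (isoGaussianDensity_pos m hv _).le, Complex.real_smul]

lemma isoGaussian_le_smul_volume (m : EuclideanSpace ℝ (Fin d)) {v : ℝ} (hv : 0 < v) :
    isoGaussian m v ≤ ENNReal.ofReal ((2 * Real.pi * v) ^ (-(d : ℝ) / 2)) • volume := by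
  rw [isoGaussian_eq_withDensity m hv, ← withDensity_const]
  exact withDensity_mono (ae_of_all _ fun x =>
    ENNReal.ofReal_le_ofReal (isoGaussianDensity_le m hv.le x))

end Gaussian

section Entropy

lemma rnDeriv_le_of_le_smul {α : Type*} [MeasurableSpace α] {μ ν : Measure α} [SigmaFinite ν]
    {c : ENNReal} (h : μ ≤ c • ν) : μ.rnDeriv ν ≤ᵐ[ν] fun _ => c := by
  refine ae_le_of_forall_setLIntegral_le_of_sigmaFinite (μ.measurable_rnDeriv ν) fun s _ _ => ?_
  rw [setLIntegral_const]
  exact (Measure.setLIntegral_rnDeriv_le s).trans (h s)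

lemma mul_neg_log_le_negMulLog {p C : ℝ} (hp : 0 ≤ p) (hpC : p ≤ C) :
    p * -Real.log C ≤ Real.negMulLog p := by
  rcases hp.eq_or_lt with rfl | hp
  · simp
  · have := mul_le_mul_of_nonneg_left (Real.log_le_log hp hpC) hp.le
    rw [Real.negMulLog]
    linarith

lemma negMulLog_le_mul_neg_log_add_sub {p q : ℝ} (hp : 0 ≤ p) (hq : 0 < q) :
    Real.negMulLog p ≤ p * -Real.log q + (q - p) := by
  rcases hp.eq_or_lt with rfl | hp
  · simpa using hq.le
  · have h := mul_le_mul_of_nonneg_left (Real.log_le_sub_one_of_pos (div_pos hq hp)) hp.le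
    rw [Real.log_div hq.ne' hp.ne', mul_sub, mul_sub, mul_div_cancel₀ _ hp.ne'] at h
    rw [Real.negMulLog]
    linarith

variable {d : ℕ} {ν : Measure (EuclideanSpace ℝ (Fin d))} {q : EuclideanSpace ℝ (Fin d) → ℝ}
  {C : ℝ}

lemma ae_mul_neg_log_le_entropyIntegrand (hC : 0 ≤ C)
    (hν : ν ≤ ENNReal.ofReal C • volume) :
    ∀ᵐ x, (ν.rnDeriv volume x).toReal * -Real.log C ≤ entropyIntegrand ν x := by
  filter_upwards [rnDeriv_le_of_le_smul hν] with x hx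
  exact mul_neg_log_le_negMulLog ENNReal.toReal_nonneg (ENNReal.toReal_le_of_le_ofReal hC hx)

lemma integrable_crossEntropyIntegrand [IsFiniteMeasure ν] (hac : ν ≪ volume)
    (hq : Integrable q) (hlog : Integrable (fun x => -Real.log (q x)) ν) :
    Integrable fun x => (ν.rnDeriv volume x).toReal * -Real.log (q x) +
      (q x - (ν.rnDeriv volume x).toReal) :=
  ((integrable_rnDeriv_smul_iff hac).2 hlog).add (hq.sub Measure.integrable_toReal_rnDeriv)

lemma hasShannonEntropy_of_le_smul_volume [IsFiniteMeasure ν] (hC : 0 ≤ C)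
    (hν : ν ≤ ENNReal.ofReal C • volume) (hq0 : ∀ x, 0 < q x) (hq : Integrable q)
    (hlog : Integrable (fun x => -Real.log (q x)) ν) : HasShannonEntropy ν := by
  have hac : ν ≪ volume := Measure.absolutelyContinuous_of_le_smul hν
  have hmeas : Measurable (entropyIntegrand ν) :=
    Real.continuous_negMulLog.measurable.comp (ν.measurable_rnDeriv _).ennreal_toReal
  exact ⟨hac, integrable_of_le_of_le hmeas.aestronglyMeasurable
    (ae_mul_neg_log_le_entropyIntegrand hC hν)
    (ae_of_all _ fun x => negMulLog_le_mul_neg_log_add_sub ENNReal.toReal_nonneg (hq0 x))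
    (Measure.integrable_toReal_rnDeriv.mul_const _)
    (integrable_crossEntropyIntegrand hac hq hlog)⟩

lemma neg_log_isoGaussianDensity_zero_one (x : EuclideanSpace ℝ (Fin d)) :
    -Real.log (isoGaussianDensity 0 1 x) = d / 2 * Real.log (2 * Real.pi) + ‖x‖ ^ 2 / 2 := by
  rw [log_isoGaussianDensity 0 one_pos, sub_zero, mul_one, mul_one]
  ring

lemma integrable_neg_log_isoGaussianDensity_zero_one [IsFiniteMeasure ν]
    (h2 : Integrable (fun x => ‖x‖ ^ 2) ν) :
    Integrable (fun x => -Real.log (isoGaussianDensity 0 1 x)) ν := by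
  simp_rw [neg_log_isoGaussianDensity_zero_one]
  exact (integrable_const _).add (h2.div_const 2)

lemma hasShannonEntropy_of_integrable_norm_sq [IsFiniteMeasure ν] (hC : 0 ≤ C)
    (hν : ν ≤ ENNReal.ofReal C • volume) (h2 : Integrable (fun x => ‖x‖ ^ 2) ν) :
    HasShannonEntropy ν :=
  hasShannonEntropy_of_le_smul_volume hC hν (isoGaussianDensity_pos 0 one_pos)
    (integrable_isoGaussianDensity 0 one_pos) (integrable_neg_log_isoGaussianDensity_zero_one h2)

lemma integrable_norm_sq_isoGaussian (m : EuclideanSpace ℝ (Fin d)) (v : ℝ) :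
    Integrable (fun x => ‖x‖ ^ 2) (isoGaussian m v) :=
  (memLp_two_iff_integrable_sq_norm aestronglyMeasurable_id).1 IsGaussian.memLp_two_id

lemma hasShannonEntropy_isoGaussian (m : EuclideanSpace ℝ (Fin d)) {v : ℝ} (hv : 0 < v) :
    HasShannonEntropy (isoGaussian m v) :=
  hasShannonEntropy_of_integrable_norm_sq (by positivity) (isoGaussian_le_smul_volume m hv)
    (integrable_norm_sq_isoGaussian m v)

variable [IsProbabilityMeasure ν]

lemma neg_log_le_shannonEntropy (hC : 0 ≤ C) (hν : ν ≤ ENNReal.ofReal C • volume)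
    (hH : HasShannonEntropy ν) : -Real.log C ≤ shannonEntropy ν := by
  have h := integral_mono_ae (Measure.integrable_toReal_rnDeriv.mul_const _) hH.2
    (ae_mul_neg_log_le_entropyIntegrand hC hν)
  rwa [integral_mul_const, Measure.integral_toReal_rnDeriv hH.1, probReal_univ, one_mul] at h

lemma shannonEntropy_le_crossEntropy (hH : HasShannonEntropy ν) (hq0 : ∀ x, 0 < q x)
    (hq : Integrable q) (hq1 : ∫ x, q x = 1) (hlog : Integrable (fun x => -Real.log (q x)) ν) :
    shannonEntropy ν ≤ ∫ x, -Real.log (q x) ∂ν := by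
  have hmid : Integrable fun x => (ν.rnDeriv volume x).toReal * -Real.log (q x) :=
    (integrable_rnDeriv_smul_iff hH.1).2 hlog
  have hmass : Integrable fun x => (ν.rnDeriv volume x).toReal :=
    Measure.integrable_toReal_rnDeriv
  have hexcess : Integrable fun x => q x - (ν.rnDeriv volume x).toReal := hq.sub hmass
  calc shannonEntropy ν
      ≤ ∫ x, ((ν.rnDeriv volume x).toReal * -Real.log (q x) +
          (q x - (ν.rnDeriv volume x).toReal)) :=
        integral_mono hH.2 (integrable_crossEntropyIntegrand hH.1 hq hlog) fun x =>
          negMulLog_le_mul_neg_log_add_sub ENNReal.toReal_nonneg (hq0 x)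
    _ = ∫ x, (ν.rnDeriv volume x).toReal * -Real.log (q x) := by
        rw [integral_add hmid hexcess, integral_sub hq hmass, hq1,
          Measure.integral_toReal_rnDeriv hH.1, probReal_univ, sub_self, add_zero]
    _ = ∫ x, -Real.log (q x) ∂ν := integral_rnDeriv_smul hH.1

lemma shannonEntropy_le_of_integrable_norm_sq (hH : HasShannonEntropy ν)
    (h2 : Integrable (fun x => ‖x‖ ^ 2) ν) :
    shannonEntropy ν ≤ d / 2 * Real.log (2 * Real.pi) + (∫ x, ‖x‖ ^ 2 ∂ν) / 2 := by
  refine (shannonEntropy_le_crossEntropy hH (isoGaussianDensity_pos 0 one_pos)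
    (integrable_isoGaussianDensity 0 one_pos) (integral_isoGaussianDensity 0 one_pos)
    (integrable_neg_log_isoGaussianDensity_zero_one h2)).trans_eq ?_
  simp_rw [neg_log_isoGaussianDensity_zero_one]
  rw [integral_add (integrable_const _) (h2.div_const 2), integral_div, integral_const,
    probReal_univ, one_smul]

end Entropy

section NoisyStep

variable {E : Type*} [NormedAddCommGroup E] [NormedSpace ℝ E] {U : E → E}

/-- One noisy step `θ - η U(θ) + σ ε` of the iteration, for `z = (θ, ε)`. -/
def noisyStep (U : E → E) (η σ : ℝ) (z : E × E) : E :=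
  z.1 - η • U z.1 + σ • z.2

/-- The bath entropy production of a noisy step, multiplied by `σ²`. No `σ` is left in a
denominator, so that `σ = 0` is allowed and gives the small-noise limit. -/
def scaledBathEntropy (U : E → E) (η σ : ℝ) (z : E × E) : ℝ :=
  (‖η • (U z.1 + U (noisyStep U η σ z)) - σ • z.2‖ ^ 2 - ‖σ • z.2‖ ^ 2) / 2

/-- The limit, as `σ → 0`, of `σ²` times the bath entropy production of a noisy step from `x`. -/
def zeroNoiseBathEntropy (U : E → E) (η : ℝ) (x : E) : ℝ :=
  ‖η • (U x + U (x - η • U x))‖ ^ 2 / 2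

lemma scaledBathEntropy_zero (U : E → E) (η : ℝ) (z : E × E) :
    scaledBathEntropy U η 0 z = zeroNoiseBathEntropy U η z.1 := by
  simp [scaledBathEntropy, zeroNoiseBathEntropy, noisyStep]

lemma continuous_noisyStep (hU : Continuous U) (η : ℝ) :
    Continuous fun w : ℝ × E × E => noisyStep U η w.1 w.2 := by
  unfold noisyStep
  fun_prop

lemma continuous_scaledBathEntropy (hU : Continuous U) (η : ℝ) :
    Continuous fun w : ℝ × E × E => scaledBathEntropy U η w.1 w.2 := by
  have := continuous_noisyStep hU η
  unfold scaledBathEntropy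
  fun_prop

lemma continuous_zeroNoiseBathEntropy (hU : Continuous U) (η : ℝ) :
    Continuous (zeroNoiseBathEntropy U η) := by
  unfold zeroNoiseBathEntropy
  fun_prop

namespace HasPolynomialGrowth

lemma noisyStep (hU : HasPolynomialGrowth U) (η : ℝ) :
    HasPolynomialGrowth fun w : ℝ × E × E => noisyStep U η w.1 w.2 :=
  have hθ : HasPolynomialGrowth fun w : ℝ × E × E => w.2.1 := fst.comp snd
  (hθ.sub ((const η).smul (hU.comp hθ))).add (fst.smul (snd.comp snd))

lemma scaledBathEntropy (hU : HasPolynomialGrowth U) (η : ℝ) :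
    HasPolynomialGrowth fun w : ℝ × E × E => scaledBathEntropy U η w.1 w.2 :=
  have hnoise : HasPolynomialGrowth fun w : ℝ × E × E => w.1 • w.2.2 := fst.smul (snd.comp snd)
  have hdrift := (const η).smul ((hU.comp (fst.comp snd)).add (hU.comp (hU.noisyStep η)))
  ((hdrift.sub hnoise).norm_sq.sub hnoise.norm_sq).div_const 2

lemma zeroNoiseBathEntropy (hU : HasPolynomialGrowth U) (η : ℝ) :
    HasPolynomialGrowth (zeroNoiseBathEntropy U η) :=
  have hid : HasPolynomialGrowth fun x : E => x := of_lipschitzWith .id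
  ((const η).smul (hU.add (hU.comp (hid.sub ((const η).smul hU))))).norm_sq.div_const 2

end HasPolynomialGrowth

lemma isBigO_zeroNoiseBathEntropy_sub {x : E}
    (hloc : (fun y => U y - U x) =O[𝓝 x] fun y => y - x) :
    (fun η : ℝ => zeroNoiseBathEntropy U η x - 2 * η ^ 2 * ‖U x‖ ^ 2) =O[𝓝 0]
      fun η : ℝ => η ^ 3 := by
  have hstep : Tendsto (fun η : ℝ => x - η • U x) (𝓝 0) (𝓝 x) := by
    refine Continuous.tendsto' (by fun_prop) _ _ ?_
    rw [zero_smul, sub_zero]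
  have hU : (fun η : ℝ => U (x - η • U x) - U x) =O[𝓝 0] fun η : ℝ => η := by
    refine (hloc.comp_tendsto hstep).trans (.of_bound ‖U x‖ (.of_forall fun η => ?_))
    rw [Function.comp_apply, sub_sub_cancel_left, norm_neg, norm_smul, mul_comm]
  have hdiff : (fun η : ℝ => ‖U x + U (x - η • U x)‖ - 2 * ‖U x‖) =O[𝓝 0] fun η : ℝ => η := by
    refine (isBigO_of_le _ fun η => ?_).trans hU
    have htwo : 2 * ‖U x‖ = ‖U x + U x‖ := by rw [← two_smul ℝ, norm_smul, Real.norm_two]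
    rw [htwo, Real.norm_eq_abs, ← add_sub_add_left_eq_sub _ (U x) (U x)]
    exact abs_norm_sub_norm_le _ _
  have hsum : (fun η : ℝ => ‖U x + U (x - η • U x)‖ + 2 * ‖U x‖) =O[𝓝 0] fun _ => (1 : ℝ) := by
    have hone : (fun η : ℝ => η) =O[𝓝 0] fun _ => (1 : ℝ) :=
      continuous_id.continuousAt.isBigO_one ℝ
    exact ((hdiff.trans hone).add (isBigO_const_one ℝ (4 * ‖U x‖) _)).congr_left fun η => by ring
  have hsq : (fun η : ℝ => 2⁻¹ * η ^ 2) =O[𝓝 0] fun η : ℝ => η ^ 2 :=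
    (isBigO_refl _ _).const_mul_left _
  refine (hsq.mul (hdiff.mul hsum)).congr (fun η => ?_) fun η => by ring
  rw [zeroNoiseBathEntropy, norm_smul, mul_pow, Real.norm_eq_abs, sq_abs]
  ring

end NoisyStep

section EntropyOfStep

variable {d : ℕ} {U : EuclideanSpace ℝ (Fin d) → EuclideanSpace ℝ (Fin d)}

lemma bathEntropy_eq (U : EuclideanSpace ℝ (Fin d) → EuclideanSpace ℝ (Fin d)) (η : ℝ) {σ : ℝ}
    (hσ : 0 < σ) (x y : EuclideanSpace ℝ (Fin d)) :
    bathEntropy U η σ x y =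
      (‖x - (y - η • U y)‖ ^ 2 - ‖y - (x - η • U x)‖ ^ 2) / (2 * σ ^ 2) := by
  have hσ2 := pow_pos hσ 2
  unfold bathEntropy transitionDensity
  rw [Real.log_div (isoGaussianDensity_pos _ hσ2 _).ne' (isoGaussianDensity_pos _ hσ2 _).ne',
    log_isoGaussianDensity _ hσ2, log_isoGaussianDensity _ hσ2]
  ring

lemma bathEntropy_noisyStep (U : EuclideanSpace ℝ (Fin d) → EuclideanSpace ℝ (Fin d)) (η : ℝ)
    {σ : ℝ} (hσ : 0 < σ) (z : EuclideanSpace ℝ (Fin d) × EuclideanSpace ℝ (Fin d)) :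
    bathEntropy U η σ z.1 (noisyStep U η σ z) = (σ ^ 2)⁻¹ * scaledBathEntropy U η σ z := by
  have hforward : noisyStep U η σ z - (z.1 - η • U z.1) = σ • z.2 := add_sub_cancel_left _ _
  have hbackward : z.1 - (noisyStep U η σ z - η • U (noisyStep U η σ z)) =
      η • (U z.1 + U (noisyStep U η σ z)) - σ • z.2 := by
    rw [← hforward, smul_add]
    abel
  rw [bathEntropy_eq U η hσ, hforward, hbackward, scaledBathEntropy]
  field_simp

lemma totalEntropy_noisyStep (U : EuclideanSpace ℝ (Fin d) → EuclideanSpace ℝ (Fin d))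
    (μ : EuclideanSpace ℝ (Fin d)) (η τ : ℝ) {σ : ℝ} (hσ : 0 < σ)
    (z : EuclideanSpace ℝ (Fin d) × EuclideanSpace ℝ (Fin d)) :
    totalEntropy U μ η τ σ (z.1, noisyStep U η σ z) =
      (σ ^ 2)⁻¹ * scaledBathEntropy U η σ z + systemEntropy U μ η τ σ := by
  rw [← bathEntropy_noisyStep U η hσ, totalEntropy]

lemma measurable_noisyStep (hU : Measurable U) (η σ : ℝ) : Measurable (noisyStep U η σ) := by
  unfold noisyStep
  fun_prop

lemma measurable_totalEntropy (hU : Measurable U) (μ : EuclideanSpace ℝ (Fin d)) (η τ σ : ℝ) :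
    Measurable (totalEntropy U μ η τ σ) := by
  unfold totalEntropy bathEntropy transitionDensity isoGaussianDensity
  fun_prop

lemma jointLaw_eq_map (U : EuclideanSpace ℝ (Fin d) → EuclideanSpace ℝ (Fin d))
    (μ : EuclideanSpace ℝ (Fin d)) (η τ σ : ℝ) :
    jointLaw U μ η τ σ =
      ((isoGaussian μ τ).prod (isoGaussian 0 1)).map fun z => (z.1, noisyStep U η σ z) :=
  rfl

lemma nextLaw_eq_map (hU : Measurable U) (μ : EuclideanSpace ℝ (Fin d)) (η τ σ : ℝ) :
    nextLaw U μ η τ σ = ((isoGaussian μ τ).prod (isoGaussian 0 1)).map (noisyStep U η σ) := by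
  have := measurable_noisyStep hU η σ
  rw [nextLaw, jointLaw_eq_map, Measure.map_map measurable_snd (by fun_prop)]
  rfl

lemma isProbabilityMeasure_nextLaw (hU : Measurable U) (μ : EuclideanSpace ℝ (Fin d))
    (η τ σ : ℝ) : IsProbabilityMeasure (nextLaw U μ η τ σ) := by
  rw [nextLaw_eq_map hU]
  exact Measure.isProbabilityMeasure_map (measurable_noisyStep hU η σ).aemeasurable

lemma nextLaw_apply (hU : Measurable U) (μ : EuclideanSpace ℝ (Fin d)) (η τ : ℝ) {σ : ℝ}
    (hσ : 0 ≤ σ) {s : Set (EuclideanSpace ℝ (Fin d))} (hs : MeasurableSet s) :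
    nextLaw U μ η τ σ s = ∫⁻ x, isoGaussian (x - η • U x) (σ ^ 2) s ∂isoGaussian μ τ := by
  have hstep := measurable_noisyStep hU η σ
  rw [nextLaw_eq_map hU, Measure.map_apply hstep hs, Measure.prod_apply (hstep hs)]
  refine lintegral_congr fun x => ?_
  rw [isoGaussian_eq_map _ (sq_nonneg σ), Real.sqrt_sq hσ, Measure.map_apply (by fun_prop) hs]
  rfl

lemma nextLaw_le_smul_volume (hU : Measurable U) (μ : EuclideanSpace ℝ (Fin d)) (η τ : ℝ) {σ : ℝ}
    (hσ : 0 < σ) :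
    nextLaw U μ η τ σ ≤
      ENNReal.ofReal ((2 * Real.pi * σ ^ 2) ^ (-(d : ℝ) / 2)) • volume := by
  refine Measure.le_iff.2 fun s hs => ?_
  rw [nextLaw_apply hU μ η τ hσ.le hs]
  refine (lintegral_mono fun x =>
    isoGaussian_le_smul_volume (x - η • U x) (pow_pos hσ 2) s).trans_eq ?_
  rw [lintegral_const, measure_univ, mul_one]

variable (hU : Continuous U) (hUg : HasPolynomialGrowth U)
include hU hUg

lemma continuous_integral_norm_sq_noisyStep (μ : EuclideanSpace ℝ (Fin d)) (η τ : ℝ) :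
    Continuous fun σ : ℝ =>
      ∫ z, ‖noisyStep U η σ z‖ ^ 2 ∂(isoGaussian μ τ).prod (isoGaussian 0 1) :=
  (hUg.noisyStep η).norm_sq.continuous_integral (memLp_id_natCast_of_isGaussian _)
    ((continuous_noisyStep hU η).norm.pow 2)

lemma integrable_norm_sq_nextLaw (μ : EuclideanSpace ℝ (Fin d)) (η τ σ : ℝ) :
    Integrable (fun y => ‖y‖ ^ 2) (nextLaw U μ η τ σ) := by
  have hstep := measurable_noisyStep hU.measurable η σ
  rw [nextLaw_eq_map hU.measurable, integrable_map_measure (by fun_prop) hstep.aemeasurable]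
  exact (hUg.noisyStep η).norm_sq.integrable_prodMk_left (memLp_id_natCast_of_isGaussian _)
    ((continuous_noisyStep hU η).norm.pow 2) σ

lemma hasShannonEntropy_nextLaw (μ : EuclideanSpace ℝ (Fin d)) (η τ : ℝ) {σ : ℝ} (hσ : 0 < σ) :
    HasShannonEntropy (nextLaw U μ η τ σ) :=
  have := isProbabilityMeasure_nextLaw hU.measurable μ η τ σ
  hasShannonEntropy_of_integrable_norm_sq (by positivity)
    (nextLaw_le_smul_volume hU.measurable μ η τ hσ) (integrable_norm_sq_nextLaw hU hUg μ η τ σ)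

lemma shannonEntropy_nextLaw_le (μ : EuclideanSpace ℝ (Fin d)) (η τ : ℝ) {σ : ℝ} (hσ : 0 < σ) :
    shannonEntropy (nextLaw U μ η τ σ) ≤ d / 2 * Real.log (2 * Real.pi) +
      (∫ z, ‖noisyStep U η σ z‖ ^ 2 ∂(isoGaussian μ τ).prod (isoGaussian 0 1)) / 2 := by
  have := isProbabilityMeasure_nextLaw hU.measurable μ η τ σ
  have hmap : ∫ y, ‖y‖ ^ 2 ∂nextLaw U μ η τ σ =
      ∫ z, ‖noisyStep U η σ z‖ ^ 2 ∂(isoGaussian μ τ).prod (isoGaussian 0 1) := by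
    rw [nextLaw_eq_map hU.measurable,
      integral_map (measurable_noisyStep hU.measurable η σ).aemeasurable (by fun_prop)]
  rw [← hmap]
  exact shannonEntropy_le_of_integrable_norm_sq (hasShannonEntropy_nextLaw hU hUg μ η τ hσ)
    (integrable_norm_sq_nextLaw hU hUg μ η τ σ)

lemma mul_log_le_shannonEntropy_nextLaw (μ : EuclideanSpace ℝ (Fin d)) (η τ : ℝ) {σ : ℝ}
    (hσ : 0 < σ) :
    d / 2 * Real.log (2 * Real.pi * σ ^ 2) ≤ shannonEntropy (nextLaw U μ η τ σ) := by
  have := isProbabilityMeasure_nextLaw hU.measurable μ η τ σ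
  have h := neg_log_le_shannonEntropy (by positivity)
    (nextLaw_le_smul_volume hU.measurable μ η τ hσ) (hasShannonEntropy_nextLaw hU hUg μ η τ hσ)
  rw [Real.log_rpow (by positivity)] at h
  linarith

lemma tendsto_sq_mul_shannonEntropy_nextLaw (μ : EuclideanSpace ℝ (Fin d)) (η τ : ℝ) :
    Tendsto (fun σ : ℝ => σ ^ 2 * shannonEntropy (nextLaw U μ η τ σ)) (𝓝[>] 0) (𝓝 0) := by
  have hlower : Tendsto (fun σ : ℝ => σ ^ 2 * (d / 2 * Real.log (2 * Real.pi * σ ^ 2)))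
      (𝓝[>] 0) (𝓝 0) := by
    have hsq : Continuous fun σ : ℝ => 2 * Real.pi * σ ^ 2 := by fun_prop
    have hcont : Continuous fun σ : ℝ => d / (4 * Real.pi) *
        (2 * Real.pi * σ ^ 2 * Real.log (2 * Real.pi * σ ^ 2)) :=
      (Real.continuous_mul_log.comp hsq).const_mul _
    refine ((hcont.tendsto' 0 0 (by simp)).mono_left nhdsWithin_le_nhds).congr fun σ => ?_
    field_simp
    ring
  have hupper : Tendsto (fun σ : ℝ => σ ^ 2 * (d / 2 * Real.log (2 * Real.pi) +
      (∫ z, ‖noisyStep U η σ z‖ ^ 2 ∂(isoGaussian μ τ).prod (isoGaussian 0 1)) / 2))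
      (𝓝[>] 0) (𝓝 0) := by
    have := continuous_integral_norm_sq_noisyStep hU hUg μ η τ
    exact (Continuous.tendsto' (by fun_prop) 0 0 (by simp)).mono_left nhdsWithin_le_nhds
  refine tendsto_of_tendsto_of_tendsto_of_le_of_le' hlower hupper ?_ ?_ <;>
    filter_upwards [self_mem_nhdsWithin] with σ hσ
  · gcongr
    exact mul_log_le_shannonEntropy_nextLaw hU hUg μ η τ hσ
  · gcongr
    exact shannonEntropy_nextLaw_le hU hUg μ η τ hσ

lemma tendsto_sq_mul_systemEntropy (μ : EuclideanSpace ℝ (Fin d)) (η τ : ℝ) :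
    Tendsto (fun σ : ℝ => σ ^ 2 * systemEntropy U μ η τ σ) (𝓝[>] 0) (𝓝 0) := by
  have hinitial : Tendsto (fun σ : ℝ => σ ^ 2 * shannonEntropy (isoGaussian μ τ))
      (𝓝[>] 0) (𝓝 0) :=
    (Continuous.tendsto' (by fun_prop) 0 0 (by simp)).mono_left nhdsWithin_le_nhds
  simpa only [systemEntropy, mul_sub, sub_zero] using
    (tendsto_sq_mul_shannonEntropy_nextLaw hU hUg μ η τ).sub hinitial

lemma integrable_scaledBathEntropy (μ : EuclideanSpace ℝ (Fin d)) (η τ σ : ℝ) :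
    Integrable (scaledBathEntropy U η σ) ((isoGaussian μ τ).prod (isoGaussian 0 1)) :=
  (hUg.scaledBathEntropy η).integrable_prodMk_left (memLp_id_natCast_of_isGaussian _)
    (continuous_scaledBathEntropy hU η) σ

lemma integrable_totalEntropy (μ : EuclideanSpace ℝ (Fin d)) (η τ : ℝ) {σ : ℝ} (hσ : 0 < σ) :
    Integrable (totalEntropy U μ η τ σ) (jointLaw U μ η τ σ) := by
  have hstep := measurable_noisyStep hU.measurable η σ
  rw [jointLaw_eq_map, integrable_map_measure
    (measurable_totalEntropy hU.measurable μ η τ σ).aestronglyMeasurable (by fun_prop)]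
  simp only [Function.comp_def, totalEntropy_noisyStep U μ η τ hσ]
  exact ((integrable_scaledBathEntropy hU hUg μ η τ σ).const_mul _).add (integrable_const _)

lemma sq_mul_integral_totalEntropy (μ : EuclideanSpace ℝ (Fin d)) (η τ : ℝ) {σ : ℝ}
    (hσ : 0 < σ) :
    σ ^ 2 * ∫ z, totalEntropy U μ η τ σ z ∂jointLaw U μ η τ σ =
      (∫ z, scaledBathEntropy U η σ z ∂(isoGaussian μ τ).prod (isoGaussian 0 1)) +
        σ ^ 2 * systemEntropy U μ η τ σ := by
  have hstep := measurable_noisyStep hU.measurable η σ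
  rw [jointLaw_eq_map, integral_map (by fun_prop)
    (measurable_totalEntropy hU.measurable μ η τ σ).aestronglyMeasurable]
  simp only [totalEntropy_noisyStep U μ η τ hσ]
  rw [integral_add ((integrable_scaledBathEntropy hU hUg μ η τ σ).const_mul _)
    (integrable_const _), integral_const_mul, integral_const, probReal_univ, one_smul, mul_add,
    mul_inv_cancel_left₀ (pow_pos hσ 2).ne']

lemma tendsto_integral_scaledBathEntropy (μ : EuclideanSpace ℝ (Fin d)) (η τ : ℝ) :
    Tendsto (fun σ : ℝ =>
        ∫ z, scaledBathEntropy U η σ z ∂(isoGaussian μ τ).prod (isoGaussian 0 1))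
      (𝓝[>] 0) (𝓝 (∫ x, zeroNoiseBathEntropy U η x ∂isoGaussian μ τ)) := by
  have hcont := (hUg.scaledBathEntropy η).continuous_integral
    (ν := (isoGaussian μ τ).prod (isoGaussian 0 1))
    (memLp_id_natCast_of_isGaussian _) (continuous_scaledBathEntropy hU η)
  refine (hcont.tendsto' 0 _ ?_).mono_left nhdsWithin_le_nhds
  simp_rw [scaledBathEntropy_zero]
  rw [integral_fun_fst, probReal_univ, one_smul]

theorem tendsto_sq_mul_integral_totalEntropy (μ : EuclideanSpace ℝ (Fin d)) (η τ : ℝ) :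
    Tendsto (fun σ : ℝ => σ ^ 2 * ∫ z, totalEntropy U μ η τ σ z ∂jointLaw U μ η τ σ)
      (𝓝[>] 0) (𝓝 (∫ x, zeroNoiseBathEntropy U η x ∂isoGaussian μ τ)) := by
  have hlim := (tendsto_integral_scaledBathEntropy hU hUg μ η τ).add
    (tendsto_sq_mul_systemEntropy hU hUg μ η τ)
  rw [add_zero] at hlim
  refine hlim.congr' ?_
  filter_upwards [self_mem_nhdsWithin] with σ hσ
  exact (sq_mul_integral_totalEntropy hU hUg μ η τ hσ).symm

end EntropyOfStep

theorem mainTheorem5_general {d : ℕ} {U : EuclideanSpace ℝ (Fin d) → EuclideanSpace ℝ (Fin d)}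
    {μ : EuclideanSpace ℝ (Fin d)} (hU : Continuous U) (hUg : HasPolynomialGrowth U)
    (hloc : (fun y => U y - U μ) =O[𝓝 μ] fun y => y - μ) :
    (∀ η τ σ : ℝ, 0 < τ → 0 < σ →
      HasShannonEntropy (isoGaussian μ τ) ∧ HasShannonEntropy (nextLaw U μ η τ σ) ∧
        Integrable (totalEntropy U μ η τ σ) (jointLaw U μ η τ σ)) ∧
    (∀ η τ : ℝ, 0 < τ → Tendsto
      (fun σ : ℝ => σ ^ 2 * ∫ z, totalEntropy U μ η τ σ z ∂jointLaw U μ η τ σ)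
      (𝓝[>] 0) (𝓝 (∫ x, zeroNoiseBathEntropy U η x ∂isoGaussian μ τ))) ∧
    (∀ η : ℝ, Tendsto (fun τ : ℝ => ∫ x, zeroNoiseBathEntropy U η x ∂isoGaussian μ τ)
      (𝓝[>] 0) (𝓝 (zeroNoiseBathEntropy U η μ))) ∧
    (fun η : ℝ => zeroNoiseBathEntropy U η μ - 8 * η * phiST U η μ) =O[𝓝 0]
      fun η : ℝ => η ^ 3 := by
  have hexpansion : (fun η : ℝ => zeroNoiseBathEntropy U η μ - 8 * η * phiST U η μ) =O[𝓝 0]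
      fun η : ℝ => η ^ 3 := by
    refine (isBigO_zeroNoiseBathEntropy_sub hloc).congr_left fun η => ?_
    rw [phiST]
    ring
  exact ⟨fun η τ σ hτ hσ => ⟨hasShannonEntropy_isoGaussian μ hτ,
      hasShannonEntropy_nextLaw hU hUg μ η τ hσ, integrable_totalEntropy hU hUg μ η τ hσ⟩,
    fun η τ _ => tendsto_sq_mul_integral_totalEntropy hU hUg μ η τ,
    fun η => tendsto_integral_isoGaussian (continuous_zeroNoiseBathEntropy hU η)
      (hUg.zeroNoiseBathEntropy η) μ,
    hexpansion⟩

end EntropyProduction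

end

theorem mainTheorem5 {d : ℕ} (U : EuclideanSpace ℝ (Fin d) → EuclideanSpace ℝ (Fin d))
    (K : NNReal) (hU : LipschitzWith K U) (μ : EuclideanSpace ℝ (Fin d)) :
    -- all the quantities are well defined
    (∀ η τ σ : ℝ, 0 < η → 0 < τ → 0 < σ →
      EntropyProduction.HasShannonEntropy (EntropyProduction.isoGaussian μ τ) ∧
      EntropyProduction.HasShannonEntropy (EntropyProduction.nextLaw U μ η τ σ) ∧
      Integrable (EntropyProduction.totalEntropy U μ η τ σ)
        (EntropyProduction.jointLaw U μ η τ σ)) ∧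
    -- both limits exist for every step size, and the iterated limit has the stated expansion
    ∃ (S : ℝ → ℝ → ℝ) (L : ℝ → ℝ),
      (∀ η τ : ℝ, 0 < η → 0 < τ →
        Tendsto (fun σ : ℝ => σ ^ 2 *
            ∫ z, EntropyProduction.totalEntropy U μ η τ σ z ∂(EntropyProduction.jointLaw U μ η τ σ))
          (𝓝[>] 0) (𝓝 (S η τ))) ∧
      (∀ η : ℝ, 0 < η → Tendsto (fun τ : ℝ => S η τ) (𝓝[>] 0) (𝓝 (L η))) ∧
      (fun η : ℝ => L η - 8 * η * EntropyProduction.phiST U η μ) =O[𝓝[>] 0]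
        (fun η : ℝ => η ^ 3) := by
  obtain ⟨hdef, hσ, hτ, hη⟩ := EntropyProduction.mainTheorem5_general hU.continuous
    (.of_lipschitzWith hU) (μ := μ) (.of_bound K (.of_forall fun y => hU.norm_sub_le y μ))
  exact ⟨fun η τ σ _ => hdef η τ σ, _, _, fun η τ _ => hσ η τ, fun η _ => hτ η,
    hη.mono nhdsWithin_le_nhds⟩
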